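/- Let $n\ge 3$ be an integer. Equip $\mathrm{SO}(n)$ and its subgroup $\mathrm{SO}(n-1)$, the stabilizer of the first coordinate vector $e_1$, with their Haar probability measures, and let $\lambda$ be the left regular representation of $\mathrm{SO}(n)$ on the real space $L^2(\mathrm{SO}(n))$, $(\lambda(h)f)(x)=f(h^{-1}x)$. For $\delta\in[-1,1]$ put $$T_\delta=\int_{\mathrm{SO}(n-1)\times\mathrm{SO}(n-1)}\lambda(ugu')\,du\,du'\in B(L^2(\mathrm{SO}(n))),$$ where $g\in\mathrm{SO}(n)$ is any element with upper left entry $g_{11}=\delta$ (the operator depends only on $\delta$). For $v,u,t\in\mathbb R$ with $t+\frac{u}{n-2}+v=0$ let $D(v,u,t)=\mathrm{diag}(e^v,\dots,e^v,e^u,e^t,\dots,e^t)\in\mathrm{SL}(2n-3,\mathbb R)$, with $n-2$ diagonal entries $e^v$, one entry $e^u$ and $n-2$ entries $e^t$. Let $C\in\mathbb R$ and $\alpha>0$. Then there is a function $\varepsilon\in C_0(\mathbb R_+)$ (continuous on $[0,\infty)$ and vanishing at infinity), depending only on $n$, $C$ and $\alpha$, with the following property. Let $X$ be a real Banach space such that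 for all $\delta,\delta'\in[-1,1]$ $$\|(T_\delta-T_{\delta'})\otimes\mathrm{Id}_X\|_{B(L^2(\mathrm{SO}(n);X))}\le C\max(|\delta|^{\alpha},|\delta'|^{\alpha}).$$ Let $\pi$ be a strongly continuous representation of $\mathrm{SL}(2n-3,\mathbb R)$ on $X$ by invertible linear isometries, and let $\xi\in X$ and $\eta\in X^*$ be $\mathrm{SO}(2n-3)$-invariant, that is, $\pi(k)\xi=\xi$ and $\eta\circ\pi(k)=\eta$ for all $k\in\mathrm{SO}(2n-3)$. Then $\varphi(g)=\langle\pi(g)\xi,\eta\rangle$ is such that $\varphi(D(t,0,-t))$ converges to a limit $c\in\mathbb R$ as $t\to\infty$, and $$|\varphi(D(t,0,-t))-c|\le\varepsilon(t)\,\|\xi\|_X\,\|\eta\|_{X^*}\qquad\text{for all }t\ge 0.$$ -/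

import Mathlib

open MeasureTheory Topology Filter
open scoped NNReal ENNReal ZeroAtInfty

namespace SLCoeff

noncomputable section

/-- The compact group `SO(n)` of real orthogonal `n × n` matrices of determinant one. -/
abbrev SO (n : ℕ) : Type := Matrix.specialOrthogonalGroup (Fin n) ℝ

instance (n : ℕ) : IsTopologicalGroup (SO n) where
  continuous_mul := continuous_mul
  continuous_inv := by
    refine Continuous.subtype_mk (f := fun g : SO n => star (g : Matrix (Fin n) (Fin n) ℝ)) ?_ _
    exact continuous_star.comp continuous_subtype_val

instance (n : ℕ) : CompactSpace (SO n) := by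
  have hsub : (Matrix.specialOrthogonalGroup (Fin n) ℝ : Set (Matrix (Fin n) (Fin n) ℝ)) ⊆
      {M : Matrix (Fin n) (Fin n) ℝ | ∀ i j, M i j ∈ Set.Icc (-1 : ℝ) 1} := by
    intro M hM i j
    have h1 : M ∈ Matrix.unitaryGroup (Fin n) ℝ :=
      (Matrix.mem_specialOrthogonalGroup_iff.mp hM).1
    have h2 := entry_norm_bound_of_unitary h1 i j
    rw [Real.norm_eq_abs] at h2
    exact abs_le.mp h2
  have hcl : IsClosed (Matrix.specialOrthogonalGroup (Fin n) ℝ :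
      Set (Matrix (Fin n) (Fin n) ℝ)) := by
    have : (Matrix.specialOrthogonalGroup (Fin n) ℝ : Set (Matrix (Fin n) (Fin n) ℝ)) =
        {M | M * star M = 1} ∩ {M | M.det = 1} := by
      ext M
      exact Matrix.mem_specialOrthogonalGroup_iff.trans
        (and_congr_left' Matrix.mem_unitaryGroup_iff)
    rw [this]
    exact (isClosed_eq (continuous_id.mul continuous_star) continuous_const).inter
      (isClosed_eq (Continuous.matrix_det continuous_id) continuous_const)
  have hc : IsCompact {M : Matrix (Fin n) (Fin n) ℝ | ∀ i j, M i j ∈ Set.Icc (-1 : ℝ) 1} :=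
    IsCompact.matrix isCompact_Icc
  exact isCompact_iff_compactSpace.mp (hc.of_isClosed_subset hcl hsub)

instance (n : ℕ) : SecondCountableTopology (SO n) := by
  have : SecondCountableTopology (Matrix (Fin n) (Fin n) ℝ) :=
    inferInstanceAs (SecondCountableTopology (Fin n → Fin n → ℝ))
  exact TopologicalSpace.Subtype.secondCountableTopology
    (Matrix.specialOrthogonalGroup (Fin n) ℝ : Set (Matrix (Fin n) (Fin n) ℝ))

instance (n : ℕ) : T2Space (SO n) := inferInstance

instance (n : ℕ) : MeasurableSpace (SO n) := borel _

instance (n : ℕ) : BorelSpace (SO n) := ⟨rfl⟩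

/-- The Haar probability measure on `SO(n)`. -/
def haarSO (n : ℕ) : Measure (SO n) := Measure.haarMeasure ⊤

instance (n : ℕ) : (haarSO n).IsHaarMeasure := by unfold haarSO; infer_instance

instance (n : ℕ) : IsProbabilityMeasure (haarSO n) :=
  ⟨by simpa [haarSO] using Measure.haarMeasure_self (K₀ := (⊤ : TopologicalSpace.PositiveCompacts (SO n)))⟩

/-- `SO(n-1)` as the subgroup of `SO(n)` fixing the first coordinate vector. -/
def stab (n : ℕ) : Subgroup (SO n) where
  carrier := {u | ∀ i : Fin n, i.val = 0 →
    (u : Matrix (Fin n) (Fin n) ℝ).mulVec (Pi.single i 1) = Pi.single i 1}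
  mul_mem' := by
    intro a b ha hb i hi
    have : ((a * b : SO n) : Matrix (Fin n) (Fin n) ℝ) = (a : Matrix _ _ ℝ) * (b : Matrix _ _ ℝ) :=
      rfl
    rw [this, ← Matrix.mulVec_mulVec, hb i hi, ha i hi]
  one_mem' := by
    intro i _
    exact Matrix.one_mulVec _
  inv_mem' := by
    intro a ha i hi
    have h1 : ((a⁻¹ : SO n) : Matrix (Fin n) (Fin n) ℝ) * (a : Matrix _ _ ℝ) = 1 := by
      have := congrArg (Subtype.val) (inv_mul_cancel a)
      exact this
    conv_lhs => rw [← ha i hi]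
    rw [Matrix.mulVec_mulVec, h1, Matrix.one_mulVec]

instance (n : ℕ) : CompactSpace (stab n) := by
  apply isCompact_iff_compactSpace.mp
  apply IsClosed.isCompact
  have : (stab n : Set (SO n)) = ⋂ (i : Fin n) (_ : i.val = 0), {u : SO n |
      (u : Matrix (Fin n) (Fin n) ℝ).mulVec (Pi.single i 1) = Pi.single i 1} := by
    ext u
    simp [stab]
  rw [this]
  exact isClosed_iInter fun i => isClosed_iInter fun _ =>
    isClosed_eq (Continuous.matrix_mulVec continuous_subtype_val continuous_const)
      continuous_const

instance (n : ℕ) : SecondCountableTopology (stab n) :=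
  TopologicalSpace.Subtype.secondCountableTopology (stab n : Set (SO n))

/-- The Haar probability measure on `SO(n-1) ⊆ SO(n)`. -/
def haarStab (n : ℕ) : Measure (stab n) := Measure.haarMeasure ⊤

instance (n : ℕ) : (haarStab n).IsHaarMeasure := by unfold haarStab; infer_instance

instance (n : ℕ) : IsProbabilityMeasure (haarStab n) :=
  ⟨by simpa [haarStab] using
    Measure.haarMeasure_self (K₀ := (⊤ : TopologicalSpace.PositiveCompacts (stab n)))⟩

/-- The Bochner space `L²(SO(n); E)`. -/
abbrev L2 (n : ℕ) (E : Type*) [NormedAddCommGroup E] : Type _ := Lp E 2 (haarSO n)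

/-- The left regular representation: `(λ(h) f)(x) = f(h⁻¹ x)`. -/
def leftReg {n : ℕ} {E : Type*} [NormedAddCommGroup E] (h : SO n) (f : L2 n E) : L2 n E :=
  DomMulAct.mk h⁻¹ • f

/-- The defining formula of the left regular representation. -/
lemma leftReg_ae_eq {n : ℕ} {E : Type*} [NormedAddCommGroup E] (h : SO n) (f : L2 n E) :
    leftReg h f =ᵐ[haarSO n] fun x => f (h⁻¹ * x) :=
  DomMulAct.smul_Lp_ae_eq _ f

lemma continuous_leftReg {n : ℕ} {E : Type*} [NormedAddCommGroup E] (f : L2 n E) :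
    Continuous fun h : SO n => leftReg h f := by
  have : Fact ((2 : ℝ≥0∞) ≠ ∞) := ⟨by norm_num⟩
  unfold leftReg
  exact (DomMulAct.continuous_mk.comp continuous_inv).smul continuous_const

lemma integrable_leftReg {n : ℕ} (g : SO n) (f : L2 n ℝ) :
    Integrable (fun p : stab n × stab n => leftReg ((p.1 : SO n) * g * (p.2 : SO n)) f)
      ((haarStab n).prod (haarStab n)) := by
  refine Continuous.integrable_of_hasCompactSupport ?_ (HasCompactSupport.of_compactSpace _)
  exact (continuous_leftReg f).comp (by fun_prop)

/-- The operator `∫∫ λ(u g u') du du'` on `L²(SO(n))`, the integral being over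
`SO(n-1) × SO(n-1)` with respect to the Haar probability measure. -/
def doubleAverage {n : ℕ} (g : SO n) : L2 n ℝ →L[ℝ] L2 n ℝ :=
  LinearMap.mkContinuous
    { toFun := fun f => ∫ p : stab n × stab n,
        leftReg ((p.1 : SO n) * g * (p.2 : SO n)) f ∂((haarStab n).prod (haarStab n))
      map_add' := fun f₁ f₂ => by
        rw [← integral_add (integrable_leftReg g f₁) (integrable_leftReg g f₂)]
        simp only [leftReg, smul_add]
      map_smul' := fun r f => by
        rw [RingHom.id_apply, ← integral_smul]
        simp only [leftReg, smul_comm _ r f] }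
    1 (fun f => by
      refine (norm_integral_le_of_norm_le_const (C := ‖f‖)
        (Eventually.of_forall fun p => ?_)).trans ?_
      · simp [leftReg]
      · simp)

/-- The identification of `{0,1} ⊔ {2,…,n-1}` with `{0,…,n-1}`. -/
def splitTwo (n : ℕ) (hn : 3 ≤ n) : Fin 2 ⊕ Fin (n - 2) ≃ Fin n :=
  finSumFinEquiv.trans (finCongr (by omega))

/-- The rotation in the plane of the first two coordinates whose upper left entry is `δ`. -/
def rotation (n : ℕ) (hn : 3 ≤ n) (δ : Set.Icc (-1 : ℝ) 1) : SO n :=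
  ⟨Matrix.reindex (splitTwo n hn) (splitTwo n hn)
    (Matrix.fromBlocks !![(δ : ℝ), -√(1 - (δ : ℝ) ^ 2); √(1 - (δ : ℝ) ^ 2), (δ : ℝ)] 0 0 1), by
    have h : √(1 - (δ : ℝ) ^ 2) * √(1 - (δ : ℝ) ^ 2) = 1 - (δ : ℝ) ^ 2 :=
      Real.mul_self_sqrt (by nlinarith [δ.2.1, δ.2.2])
    rw [Matrix.mem_specialOrthogonalGroup_iff]
    constructor
    · rw [Matrix.mem_orthogonalGroup_iff, Matrix.transpose_reindex,
        Matrix.reindex_apply, Matrix.reindex_apply, Matrix.submatrix_mul_equiv,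
        Matrix.fromBlocks_transpose, Matrix.fromBlocks_multiply]
      have : (!![(δ : ℝ), -√(1 - (δ : ℝ) ^ 2); √(1 - (δ : ℝ) ^ 2), (δ : ℝ)] *
          Matrix.transpose !![(δ : ℝ), -√(1 - (δ : ℝ) ^ 2); √(1 - (δ : ℝ) ^ 2), (δ : ℝ)]) = 1 := by
        ext i j
        fin_cases i <;> fin_cases j <;> simp [Matrix.mul_apply, Fin.sum_univ_two] <;> nlinarith
      simp [this]
    · rw [Matrix.det_reindex_self, Matrix.det_fromBlocks_zero₁₂, Matrix.det_fin_two_of]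
      simp only [Matrix.det_one, mul_one]
      nlinarith⟩

lemma rotation_apply_zero (n : ℕ) (hn : 3 ≤ n) (δ : Set.Icc (-1 : ℝ) 1) :
    (rotation n hn δ : Matrix (Fin n) (Fin n) ℝ) ⟨0, by omega⟩ ⟨0, by omega⟩ = δ := by
  have h0 : (⟨0, by omega⟩ : Fin n) = splitTwo n hn (Sum.inl 0) := by
    ext; simp [splitTwo]
  simp [rotation, h0]

/-- The operator `T_δ` on `L²(SO(n))`. It is `∫∫ λ(u g u') du du'` for an element `g` of `SO(n)`
with upper left entry `δ`; all such `g` lie in one double coset of `SO(n-1)`, so that it does not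
matter which one is used. -/
def T (n : ℕ) (hn : 3 ≤ n) (δ : Set.Icc (-1 : ℝ) 1) : L2 n ℝ →L[ℝ] L2 n ℝ :=
  doubleAverage (rotation n hn δ)

/-- The elementary tensor `f ⊗ x`, that is the function `g ↦ f(g) x` in `L²(SO(n); X)`. -/
def tmul {n : ℕ} {X : Type*} [NormedAddCommGroup X] [NormedSpace ℝ X] (f : L2 n ℝ) (x : X) :
    L2 n X :=
  (ContinuousLinearMap.toSpanSingleton ℝ x).compLp f

/-- `‖A ⊗ Id_X‖ ≤ K` as an operator on `L²(SO(n); X)`: the operator `A ⊗ Id_X`, defined on the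
(dense) span of the elementary tensors, extends to a bounded operator on `L²(SO(n); X)` of norm at
most `K`. -/
def TensorIdNormLE {n : ℕ} (X : Type*) [NormedAddCommGroup X] [NormedSpace ℝ X]
    (A : L2 n ℝ →L[ℝ] L2 n ℝ) (K : ℝ) : Prop :=
  ∃ S : L2 n X →L[ℝ] L2 n X, (∀ (f : L2 n ℝ) (x : X), S (tmul f x) = tmul (A f) x) ∧ ‖S‖ ≤ K

/-- The estimate `‖(T_δ - T_δ') ⊗ Id_X‖ ≤ C max(|δ|^α, |δ'|^α)` for all `δ, δ' ∈ [-1,1]`. -/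
def SphereEstimate (n : ℕ) (hn : 3 ≤ n) (X : Type*) [NormedAddCommGroup X] [NormedSpace ℝ X]
    (C α : ℝ) : Prop :=
  ∀ δ δ' : Set.Icc (-1 : ℝ) 1,
    TensorIdNormLE X (T n hn δ - T n hn δ') (C * max (|(δ : ℝ)| ^ α) (|(δ' : ℝ)| ^ α))

/-- The real special linear group `SL(m, ℝ)`. -/
abbrev SL (m : ℕ) : Type := Matrix.SpecialLinearGroup (Fin m) ℝ

/-- The diagonal matrix `diag(e^v, …, e^v, e^u, e^t, …, e^t)` of `SL(2n-3, ℝ)`, with `n-2` entries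
`e^v`, one entry `e^u` and `n-2` entries `e^t`. -/
def D (n : ℕ) (hn : 3 ≤ n) (v u t : ℝ) (h : t + u / ((n : ℝ) - 2) + v = 0) : SL (2 * n - 3) :=
  ⟨Matrix.diagonal fun i : Fin (2 * n - 3) =>
    if i.val < n - 2 then Real.exp v else if i.val = n - 2 then Real.exp u else Real.exp t, by
    obtain ⟨k, rfl⟩ : ∃ k, n = k + 3 := ⟨n - 3, by omega⟩
    rw [Matrix.det_diagonal, Fin.prod_univ_eq_prod_range (fun i : ℕ =>
      if i < k + 3 - 2 then Real.exp v else if i = k + 3 - 2 then Real.exp u else Real.exp t)]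
    have e : 2 * (k + 3) - 3 = (k + 1) + 1 + (k + 1) := by omega
    have e' : k + 3 - 2 = k + 1 := by omega
    rw [e, e', Finset.prod_range_add, Finset.prod_range_succ]
    have h1 : ∏ i ∈ Finset.range (k + 1), (if i < k + 1 then Real.exp v else
        if i = k + 1 then Real.exp u else Real.exp t) = Real.exp v ^ (k + 1) := by
      rw [Finset.prod_congr rfl (g := fun _ => Real.exp v)]
      · simp
      · intro i hi
        rw [if_pos (Finset.mem_range.mp hi)]
    have h2 : ∏ i ∈ Finset.range (k + 1), (if k + 1 + 1 + i < k + 1 then Real.exp v else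
        if k + 1 + 1 + i = k + 1 then Real.exp u else Real.exp t) = Real.exp t ^ (k + 1) := by
      rw [Finset.prod_congr rfl (g := fun _ => Real.exp t)]
      · simp
      · intro i _
        rw [if_neg (by omega), if_neg (by omega)]
    rw [h1, h2, if_neg (lt_irrefl _), if_pos rfl, ← Real.exp_nat_mul, ← Real.exp_nat_mul,
      ← Real.exp_add, ← Real.exp_add, Real.exp_eq_one_iff]
    push_cast at h ⊢
    have hk : (0 : ℝ) < (k : ℝ) + 1 := by positivity
    have hk' : (k : ℝ) + 3 - 2 = k + 1 := by ring
    rw [hk'] at h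
    have h3 : ((k : ℝ) + 1) * (u / (k + 1)) = u := by field_simp
    linear_combination ((k : ℝ) + 1) * h - h3⟩

end

end SLCoeff

/-! The spherical estimate is transferred to coefficients of `π` by restricting to block copies of
`SO(n)` in `SL(2n-3)`. For an isometric representation `ρ` of `SO(n)`, the map sending `x` to `g ↦
ρ(g⁻¹) x` embeds `X` isometrically in `L²(SO(n); X)` and intertwines `ρ` with the left regular
representation. Hence coefficients of `SO(n-1)`-invariant vectors obey the estimate assumed for
`T_δ` (`abs_coeff_sub_le`).

If `c` is diagonal and constant on the last `n-1` coordinates of a block, it commutes with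
`SO(n-1)`, so `π(c)ξ` and `η ∘ π(c)` are `SO(n-1)`-invariant. Let `k_δ` rotate the first two
coordinates of the block. The Cartan projection of `c k_δ c` has an exponent `z` of multiplicity
`n-2`, exponents `x`, `y` in the plane with `x + y` fixed by `c`, and `δ = (e^x - e^y) / (e^(x+y-z)
- e^z)`. When `x` and `y` both exceed `z`, or both lie below it, by at least `d`, one gets `|δ| ≤
e^(-d)`. Redistributing two such exponents therefore changes the coefficient by `O(e^(-αd))`
(`abs_coeff_pair_sub_le`).

Since `2n-3 = (n-2) + 1 + (n-2)`, either outer block can serve as the repeated exponent while the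
other is moved against the middle one (`abs_coeff_block_sub_le`). The path `D(s, 0, -s)`, `D(s+r,
-(n-2)r, -s)`, `D(s+r, 0, -s-r)` has increments `O(e^(-αs))` for `0 ≤ r ≤ 1`, which gives
exponential convergence. -/

namespace SLCoeff

/-! ### Transference from the regular representation to isometric representations. -/

section Transference

variable {n : ℕ} {X : Type*} [NormedAddCommGroup X] [NormedSpace ℝ X]

lemma integrable_leftReg_vec {X : Type*} [NormedAddCommGroup X] (g : SO n) (F : L2 n X) :
    Integrable (fun p : stab n × stab n => leftReg ((p.1 : SO n) * g * (p.2 : SO n)) F)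
      ((haarStab n).prod (haarStab n)) := by
  refine Continuous.integrable_of_hasCompactSupport ?_ (HasCompactSupport.of_compactSpace _)
  exact (continuous_leftReg F).comp (by fun_prop)

/-- The vector-valued version of `doubleAverage`. -/
noncomputable def doubleAverageVec (X : Type*) [NormedAddCommGroup X] [NormedSpace ℝ X]
    (g : SO n) : L2 n X →L[ℝ] L2 n X :=
  LinearMap.mkContinuous
    { toFun := fun F => ∫ p : stab n × stab n,
        leftReg ((p.1 : SO n) * g * (p.2 : SO n)) F ∂((haarStab n).prod (haarStab n))
      map_add' := fun F₁ F₂ => by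
        rw [← integral_add (integrable_leftReg_vec g F₁) (integrable_leftReg_vec g F₂)]
        simp only [leftReg, smul_add]
      map_smul' := fun r F => by
        rw [RingHom.id_apply, ← integral_smul]
        simp only [leftReg, smul_comm _ r F] }
    1 (fun F => by
      refine (norm_integral_le_of_norm_le_const (C := ‖F‖)
        (Eventually.of_forall fun p => ?_)).trans ?_
      · simp [leftReg]
      · simp)

lemma doubleAverageVec_apply (g : SO n) (F : L2 n X) :
    doubleAverageVec X g F = ∫ p : stab n × stab n,
      leftReg ((p.1 : SO n) * g * (p.2 : SO n)) F ∂((haarStab n).prod (haarStab n)) := rfl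

lemma doubleAverage_apply (g : SO n) (f : L2 n ℝ) :
    doubleAverage g f = ∫ p : stab n × stab n,
      leftReg ((p.1 : SO n) * g * (p.2 : SO n)) f ∂((haarStab n).prod (haarStab n)) := rfl

lemma tmul_eq_compLpL (f : L2 n ℝ) (x : X) :
    tmul f x = (ContinuousLinearMap.toSpanSingleton ℝ x).compLpL 2 (haarSO n) f := rfl

lemma measurePreserving_const_mul (h : SO n) :
    MeasurePreserving (fun x => h * x) (haarSO n) (haarSO n) :=
  measurePreserving_mul_left _ h

lemma leftReg_tmul (h : SO n) (f : L2 n ℝ) (x : X) :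
    leftReg h (tmul f x) = tmul (leftReg h f) x := by
  apply Lp.ext
  have h1 := leftReg_ae_eq h (tmul f x)
  have h2 := (ContinuousLinearMap.toSpanSingleton ℝ x).coeFn_compLp (leftReg h f)
  have h3 := (ContinuousLinearMap.toSpanSingleton ℝ x).coeFn_compLp f
  have h4 := (measurePreserving_const_mul (h⁻¹)).quasiMeasurePreserving.ae h3
  filter_upwards [h1, h2, h4, leftReg_ae_eq h f] with g h1 h2 h4 h5
  rw [h1]
  unfold tmul at *
  rw [h2, h4, h5]

lemma doubleAverageVec_tmul [CompleteSpace X] (g : SO n) (f : L2 n ℝ) (x : X) :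
    doubleAverageVec X g (tmul f x) = tmul (doubleAverage g f) x := by
  rw [doubleAverageVec_apply, doubleAverage_apply, tmul_eq_compLpL (∫ _, _ ∂_),
    ← ContinuousLinearMap.integral_comp_comm _ (integrable_leftReg g f)]
  simp only [← tmul_eq_compLpL, leftReg_tmul]

/-- Simple functions are thus sums of elementary tensors, so `ext_tmul` follows by density. -/
lemma indicatorConstLp_eq_tmul {s : Set (SO n)} (hs : MeasurableSet s) (x : X) :
    indicatorConstLp 2 hs (measure_ne_top (haarSO n) s) x =
      tmul (indicatorConstLp 2 hs (measure_ne_top (haarSO n) s) (1 : ℝ)) x := by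
  apply Lp.ext
  have h2 := (ContinuousLinearMap.toSpanSingleton ℝ x).coeFn_compLp
    (indicatorConstLp 2 hs (measure_ne_top (haarSO n) s) (1 : ℝ))
  filter_upwards [h2, indicatorConstLp_coeFn (p := 2) (hs := hs)
    (hμs := measure_ne_top (haarSO n) s) (c := x), indicatorConstLp_coeFn (p := 2) (hs := hs)
    (hμs := measure_ne_top (haarSO n) s) (c := (1 : ℝ))] with g h1 h2 h3
  unfold tmul
  rw [h1, h2, h3]
  by_cases hg : g ∈ s <;> simp [hg]

/-- Bounded operators on `L²(SO(n); X)` are determined by their values on elementary tensors. -/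
lemma ext_tmul {A B : L2 n X →L[ℝ] L2 n X}
    (h : ∀ (f : L2 n ℝ) (x : X), A (tmul f x) = B (tmul f x)) : A = B := by
  ext1 F
  refine Lp.induction (p := 2) (by norm_num) (motive := fun F => A F = B F) ?_ ?_ ?_ F
  · intro c s hs hμ
    rw [Lp.simpleFunc.coe_indicatorConst, indicatorConstLp_eq_tmul, h]
  · intro f g hf hg _ h1 h2
    rw [map_add, map_add, h1, h2]
  · exact isClosed_eq A.continuous B.continuous

variable (ρ : SO n →* (X ≃ₗᵢ[ℝ] X)) (hρ : ∀ x, Continuous fun g => ρ g x)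

/-- The embedding `x ↦ (g ↦ ρ(g⁻¹) x)` of `X` into `L²(SO(n); X)`. -/
noncomputable def orbitEmbedding : X →ₗᵢ[ℝ] L2 n X where
  toFun x := ContinuousMap.toLp 2 (haarSO n) ℝ
    ⟨fun g => ρ g⁻¹ x, (hρ x).comp continuous_inv⟩
  map_add' x y := by
    rw [← map_add]; congr 1; ext g; simp
  map_smul' r x := by
    rw [RingHom.id_apply, ← map_smul]; congr 1; ext g; simp
  norm_map' x := by
    change ‖ContinuousMap.toLp 2 (haarSO n) ℝ _‖ = ‖x‖
    -- Since `ρ` is isometric the pointwise norm is constantly `‖x‖`, and the measure has mass one.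
    rw [Lp.norm_def, eLpNorm_congr_norm_ae (g := fun _ => x), eLpNorm_const _ (by norm_num)
      (IsProbabilityMeasure.ne_zero _)]
    · simp
    · filter_upwards [ContinuousMap.coeFn_toLp (p := 2) (𝕜 := ℝ) (haarSO n)
        (⟨fun g => ρ g⁻¹ x, (hρ x).comp continuous_inv⟩ : C(SO n, X))] with g hg
      rw [hg]
      simp

/-- The inverse in the embedding makes this work: `(h⁻¹ g)⁻¹ = g⁻¹ h`. -/
lemma leftReg_orbitEmbedding (h : SO n) (x : X) :
    leftReg h (orbitEmbedding ρ hρ x) = orbitEmbedding ρ hρ (ρ h x) := by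
  apply Lp.ext
  have h1 := ContinuousMap.coeFn_toLp (p := 2) (𝕜 := ℝ) (haarSO n)
        (⟨fun g => ρ g⁻¹ x, (hρ x).comp continuous_inv⟩ : C(SO n, X))
  have h2 := ContinuousMap.coeFn_toLp (p := 2) (𝕜 := ℝ) (haarSO n)
        (⟨fun g => ρ g⁻¹ (ρ h x), (hρ (ρ h x)).comp continuous_inv⟩ : C(SO n, X))
  have h3 := (measurePreserving_const_mul (h⁻¹)).quasiMeasurePreserving.ae h1
  filter_upwards [leftReg_ae_eq h (orbitEmbedding ρ hρ x), h2, h3] with g h4 h2 h3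
  rw [h4]
  refine h3.trans (Eq.trans ?_ h2.symm)
  change ρ (h⁻¹ * g)⁻¹ x = ρ g⁻¹ (ρ h x)
  rw [mul_inv_rev, inv_inv, map_mul]
  rfl

/-- Transference: the norm of `∫∫ ρ(u g u') - ρ(u g' u') du du'` is at most that of the
corresponding operator on `L²(SO(n); X)`. -/
lemma norm_integral_sub_le [CompleteSpace X] {g g' : SO n} {K : ℝ}
    (hρ : ∀ x, Continuous fun g => ρ g x)
    (hK : TensorIdNormLE X (doubleAverage g - doubleAverage g') K) (x : X) :
    ‖∫ p : stab n × stab n, ρ ((p.1 : SO n) * g * (p.2 : SO n)) x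
          ∂((haarStab n).prod (haarStab n)) -
        ∫ p : stab n × stab n, ρ ((p.1 : SO n) * g' * (p.2 : SO n)) x
          ∂((haarStab n).prod (haarStab n))‖ ≤ K * ‖x‖ := by
  obtain ⟨S, hS, hSK⟩ := hK
  -- The hypothesis only provides some bounded extension; agreement on elementary tensors identifies
  -- it with the Bochner-integral operator.
  have hS' : S = doubleAverageVec X g - doubleAverageVec X g' := by
    apply ext_tmul
    intro f y
    rw [hS, sub_apply, sub_apply, doubleAverageVec_tmul,
      doubleAverageVec_tmul]
    simp only [tmul_eq_compLpL, map_sub]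
  have key : ∀ k : SO n, doubleAverageVec X k (orbitEmbedding ρ hρ x) =
      orbitEmbedding ρ hρ (∫ p : stab n × stab n, ρ ((p.1 : SO n) * k * (p.2 : SO n)) x
          ∂((haarStab n).prod (haarStab n))) := by
    intro k
    rw [doubleAverageVec_apply]
    simp only [leftReg_orbitEmbedding]
    refine (orbitEmbedding ρ hρ).toContinuousLinearMap.integral_comp_comm ?_
    refine Continuous.integrable_of_hasCompactSupport ?_ (HasCompactSupport.of_compactSpace _)
    exact (hρ x).comp (by fun_prop)
  have h := S.le_of_opNorm_le hSK (orbitEmbedding ρ hρ x)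
  rwa [hS', sub_apply, key, key, ← map_sub, LinearIsometry.norm_map,
    LinearIsometry.norm_map] at h

/-- Matrix coefficients of vectors invariant under the stabilizer satisfy the sphere estimate. -/
lemma abs_coeff_sub_le [CompleteSpace X] {g g' : SO n} {K : ℝ}
    (hρ : ∀ x, Continuous fun g => ρ g x)
    (hK : TensorIdNormLE X (doubleAverage g - doubleAverage g') K) (x : X) (η : StrongDual ℝ X)
    (hx : ∀ u ∈ stab n, ρ u x = x) (hη : ∀ u ∈ stab n, ∀ y, η (ρ u y) = η y) :
    |η (ρ g x) - η (ρ g' x)| ≤ K * ‖x‖ * ‖η‖ := by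
  have key : ∀ k : SO n, η (∫ p : stab n × stab n, ρ ((p.1 : SO n) * k * (p.2 : SO n)) x
          ∂((haarStab n).prod (haarStab n))) = η (ρ k x) := by
    intro k
    rw [← η.integral_comp_comm]
    · simp [hx, hη]
    · refine Continuous.integrable_of_hasCompactSupport ?_ (HasCompactSupport.of_compactSpace _)
      exact (hρ x).comp (by fun_prop)
  rw [← key g, ← key g', ← map_sub, ← Real.norm_eq_abs, mul_comm]
  exact (η.le_opNorm _).trans
    (mul_le_mul_of_nonneg_left (norm_integral_sub_le ρ hρ hK x) (norm_nonneg _))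

end Transference

/-! ### Block rotations, diagonal matrices and the Cartan decomposition of `c k_δ c`. -/

section Matrices

/-- The diagonal matrix with entries proportional to `exp (a i)` and determinant one. -/
noncomputable def expDiag {N : ℕ} (a : Fin N → ℝ) : SL N :=
  ⟨Matrix.diagonal fun i => Real.exp (a i - (∑ j, a j) / N), by
    rw [Matrix.det_diagonal, ← Real.exp_sum, Real.exp_eq_one_iff, Finset.sum_sub_distrib]
    rcases N.eq_zero_or_pos with rfl | hN
    · simp
    · have : (N : ℝ) ≠ 0 := by positivity
      simp
      field_simp
      simp⟩

/-- Normalising the determinant lets `expDiag` take no proof argument; the correction vanishes for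
exponents of sum zero. -/
lemma coe_expDiag {N : ℕ} {a : Fin N → ℝ} (ha : ∑ j, a j = 0) :
    (expDiag a : Matrix (Fin N) (Fin N) ℝ) = Matrix.diagonal fun i => Real.exp (a i) := by
  simp [expDiag, ha]

/-- The block embedding `SO(n) → SL(N)` acting on the coordinates `σ (Sum.inl i)`. -/
def embedSO {n N : ℕ} {R : Type*} [Fintype R] [DecidableEq R] (σ : Fin n ⊕ R ≃ Fin N) :
    SO n →* SL N where
  toFun g := ⟨Matrix.reindex σ σ (Matrix.fromBlocks (g : Matrix (Fin n) (Fin n) ℝ) 0 0 1), by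
    rw [Matrix.det_reindex_self, Matrix.det_fromBlocks_zero₁₂, Matrix.det_one, mul_one]
    exact (Matrix.mem_specialOrthogonalGroup_iff.mp g.2).2⟩
  map_one' := by
    apply Subtype.ext
    simp
  map_mul' g h := by
    apply Subtype.ext
    change _ = Matrix.reindex σ σ (Matrix.fromBlocks (g : Matrix (Fin n) (Fin n) ℝ) 0 0 1) *
      Matrix.reindex σ σ (Matrix.fromBlocks (h : Matrix (Fin n) (Fin n) ℝ) 0 0 1)
    simp [Matrix.fromBlocks_multiply, Matrix.submatrix_mul_equiv]

variable {n N : ℕ} {R : Type*} [Fintype R] [DecidableEq R] (σ : Fin n ⊕ R ≃ Fin N)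

lemma coe_embedSO (g : SO n) : (embedSO σ g : Matrix (Fin N) (Fin N) ℝ) =
    (Matrix.fromBlocks (g : Matrix (Fin n) (Fin n) ℝ) 0 0 1).submatrix σ.symm σ.symm := rfl

lemma embedSO_mem (g : SO n) :
    (embedSO σ g : Matrix (Fin N) (Fin N) ℝ) ∈ Matrix.specialOrthogonalGroup (Fin N) ℝ := by
  rw [Matrix.mem_specialOrthogonalGroup_iff]
  refine ⟨?_, (embedSO σ g).2⟩
  have hg := (Matrix.mem_orthogonalGroup_iff _ _).mp
    (Matrix.mem_specialOrthogonalGroup_iff.mp g.2).1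
  rw [Matrix.mem_orthogonalGroup_iff, coe_embedSO, Matrix.transpose_submatrix,
    Matrix.submatrix_mul_equiv, Matrix.fromBlocks_transpose, Matrix.fromBlocks_multiply]
  simp [hg]

lemma continuous_embedSO : Continuous (embedSO σ) := by
  refine Continuous.subtype_mk (f := fun g : SO n =>
    (Matrix.fromBlocks (g : Matrix (Fin n) (Fin n) ℝ) 0 0 1).submatrix σ.symm σ.symm) ?_ _
  exact (Continuous.matrix_fromBlocks continuous_subtype_val continuous_const continuous_const
    continuous_const).matrix_submatrix _ _

/-- The coordinates `Fin N`, split into a plane, `n - 2` further coordinates, and the others. -/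
def splitPlane (hn : 3 ≤ n) (σ : Fin n ⊕ R ≃ Fin N) : (Fin 2 ⊕ Fin (n - 2)) ⊕ R ≃ Fin N :=
  ((splitTwo n hn).sumCongr (Equiv.refl R)).trans σ

lemma coe_embedSO_rotation (hn : 3 ≤ n) (δ : Set.Icc (-1 : ℝ) 1) :
    (embedSO σ (rotation n hn δ) : Matrix (Fin N) (Fin N) ℝ) =
    (Matrix.fromBlocks (Matrix.fromBlocks
      !![(δ : ℝ), -√(1 - (δ : ℝ) ^ 2); √(1 - (δ : ℝ) ^ 2), (δ : ℝ)] 0 0 1) 0 0 1).submatrix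
        (splitPlane hn σ).symm (splitPlane hn σ).symm := by
  rw [coe_embedSO]
  ext i j
  obtain ⟨i, rfl⟩ := (splitPlane hn σ).surjective i
  obtain ⟨j, rfl⟩ := (splitPlane hn σ).surjective j
  rcases i with i | i <;> rcases j with j | j <;> simp [splitPlane, rotation]

/-- The same nested block form as in `coe_embedSO_rotation`, so that products can be computed block
by block. -/
lemma diagonal_eq_submatrix {R : Type*} [DecidableEq R] (τ : (Fin 2 ⊕ Fin (n - 2)) ⊕ R ≃ Fin N) (d : Fin N → ℝ) :
    Matrix.diagonal d = (Matrix.fromBlocks (Matrix.fromBlocks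
      !![d (τ (.inl (.inl 0))), 0; 0, d (τ (.inl (.inl 1)))] 0 0
        (Matrix.diagonal fun k => d (τ (.inl (.inr k))))) 0 0
        (Matrix.diagonal fun r => d (τ (.inr r)))).submatrix τ.symm τ.symm := by
  ext i j
  obtain ⟨i, rfl⟩ := τ.surjective i
  obtain ⟨j, rfl⟩ := τ.surjective j
  rcases i with (i | i) | i <;> rcases j with (j | j) | j <;>
    simp [Matrix.diagonal_apply]
  fin_cases i <;> fin_cases j <;> simp

/-- The `KAK` decomposition of `diag(P, Q) k_δ diag(P, Q)` in dimension two. -/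
lemma exists_cartan {X Y P Q δ : ℝ} (hX : 0 < X) (hY : 0 < Y) (hP : 0 < P) (hQ : 0 < Q)
    (hPQ : P ^ 2 * Q ^ 2 = X * Y) (hδ : δ ∈ Set.Icc (-1 : ℝ) 1)
    (h : δ * (P ^ 2 - Q ^ 2) = X - Y) :
    ∃ κ ∈ Set.Icc (-1 : ℝ) 1, κ ^ 2 * X - (1 - κ ^ 2) * Y = P ^ 2 * δ ∧
      κ * √(1 - κ ^ 2) * (X + Y) = P * Q * √(1 - δ ^ 2) ∧
      κ ^ 2 * Y - (1 - κ ^ 2) * X = Q ^ 2 * δ := by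
  -- With `κ = cos θ`, comparing traces forces `w = cos 2θ`; below, `κ` comes from the half-angle
  -- formula.
  obtain ⟨w, hw⟩ : ∃ w, w * (X + Y) = δ * (P ^ 2 + Q ^ 2) :=
    ⟨δ * (P ^ 2 + Q ^ 2) / (X + Y), by field_simp⟩
  have hδ' : 0 ≤ 1 - δ ^ 2 := by nlinarith [hδ.1, hδ.2]
  -- This identity gives both `|w| ≤ 1` and, after a square root, the off-diagonal entry.
  have hsq : (1 - w ^ 2) * (X + Y) ^ 2 = 4 * ((P * Q) ^ 2 * (1 - δ ^ 2)) := by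
    linear_combination -(w * (X + Y) + δ * (P ^ 2 + Q ^ 2)) * hw
      - (δ * (P ^ 2 - Q ^ 2) + (X - Y)) * h - 4 * hPQ
  have hw1 : 0 ≤ 1 - w ^ 2 := by
    refine nonneg_of_mul_nonneg_left (b := (X + Y) ^ 2) ?_ (by positivity)
    rw [hsq]; positivity
  have hw2 : -1 ≤ w ∧ w ≤ 1 := by constructor <;> nlinarith
  have hκ : √((1 + w) / 2) ^ 2 = (1 + w) / 2 := Real.sq_sqrt (by linarith [hw2.1])
  have hκ' : 1 - √((1 + w) / 2) ^ 2 = (1 - w) / 2 := by rw [hκ]; ring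
  refine ⟨√((1 + w) / 2), ⟨by linarith [Real.sqrt_nonneg ((1 + w) / 2)], ?_⟩, ?_, ?_, ?_⟩
  · exact Real.sqrt_le_iff.mpr ⟨zero_le_one, by linarith [hw2.2]⟩
  · rw [hκ', hκ]; linear_combination hw / 2 - h / 2
  · rw [hκ', ← Real.sqrt_mul (by linarith [hw2.1])]
    rw [← sq_eq_sq₀ (by positivity) (by positivity), mul_pow, mul_pow, Real.sq_sqrt hδ',
      Real.sq_sqrt (by nlinarith)]
    linear_combination hsq / 4
  · rw [hκ', hκ]; linear_combination hw / 2 + h / 2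

/-- Outside the plane both sides are diagonal with equal entries, since the exponents of `c` are
half those of `a` there. In the plane this is `exists_cartan` with `P² = e^(x+y-z)` and `Q² = e^z`.
-/
lemma embedSO_rotation_conj (hn : 3 ≤ n) {a c : Fin N → ℝ} {δ : Set.Icc (-1 : ℝ) 1}
    {x y z : ℝ} (ha : ∑ j, a j = 0) (hc : ∑ j, c j = 0)
    (ha0 : a (splitPlane hn σ (.inl (.inl 0))) = x) (ha1 : a (splitPlane hn σ (.inl (.inl 1))) = y)
    (ha2 : ∀ k, a (splitPlane hn σ (.inl (.inr k))) = z)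
    (hc0 : c (splitPlane hn σ (.inl (.inl 0))) = (x + y - z) / 2)
    (hc1 : c (splitPlane hn σ (.inl (.inl 1))) = z / 2)
    (hc2 : ∀ k, c (splitPlane hn σ (.inl (.inr k))) = z / 2)
    (hc3 : ∀ r, c (splitPlane hn σ (.inr r)) = a (splitPlane hn σ (.inr r)) / 2)
    (hδ : δ * (Real.exp (x + y - z) - Real.exp z) = Real.exp x - Real.exp y) :
    ∃ κ : Set.Icc (-1 : ℝ) 1, expDiag c * embedSO σ (rotation n hn δ) * expDiag c =
      embedSO σ (rotation n hn κ) * expDiag a * embedSO σ (rotation n hn κ) := by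
  have hsq : ∀ u : ℝ, Real.exp (u / 2) ^ 2 = Real.exp u := by
    intro u; rw [← Real.exp_nat_mul]; congr 1; push_cast; ring
  obtain ⟨κ, hκ, h1, h2, h3⟩ := exists_cartan (Real.exp_pos x) (Real.exp_pos y)
    (Real.exp_pos ((x + y - z) / 2)) (Real.exp_pos (z / 2))
    (by rw [hsq, hsq, ← Real.exp_add, ← Real.exp_add]; congr 1; ring) δ.2
    (by rw [hsq, hsq]; exact hδ)
  have hκ' : √(1 - κ ^ 2) * √(1 - κ ^ 2) = 1 - κ ^ 2 :=
    Real.mul_self_sqrt (by nlinarith [hκ.1, hκ.2])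
  refine ⟨⟨κ, hκ⟩, Subtype.ext ?_⟩
  rw [Matrix.SpecialLinearGroup.coe_mul, Matrix.SpecialLinearGroup.coe_mul,
    Matrix.SpecialLinearGroup.coe_mul, Matrix.SpecialLinearGroup.coe_mul, coe_expDiag ha,
    coe_expDiag hc, coe_embedSO_rotation, coe_embedSO_rotation,
    diagonal_eq_submatrix (splitPlane hn σ) fun i => Real.exp (a i),
    diagonal_eq_submatrix (splitPlane hn σ) fun i => Real.exp (c i)]
  simp only [Matrix.submatrix_mul_equiv, Matrix.fromBlocks_multiply, Matrix.zero_mul,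
    Matrix.mul_zero, add_zero, zero_add, Matrix.mul_one, Matrix.one_mul, ha0, ha1, ha2, hc0, hc1,
    hc2, hc3, Matrix.diagonal_mul_diagonal, ← Real.exp_add, add_halves]
  congr 3
  ext i j
  fin_cases i <;> fin_cases j <;> simp
  · linear_combination -h1 + Real.exp y * hκ'
  · linear_combination h2
  · linear_combination -h2
  · linear_combination -h3 + Real.exp x * hκ'

/-- Diagonal matrices that are scalar on all but the first coordinate of the block commute with
the embedded stabilizer of the first vector. -/
lemma embedSO_stab_commute (hn : 3 ≤ n) {c : Fin N → ℝ} {w : ℝ}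
    (hc1 : c (splitPlane hn σ (.inl (.inl 1))) = w)
    (hc2 : ∀ k, c (splitPlane hn σ (.inl (.inr k))) = w) {u : SO n} (hu : u ∈ stab n) :
    expDiag c * embedSO σ u = embedSO σ u * expDiag c := by
  have hc : ∀ i : Fin n, i.val ≠ 0 → c (σ (.inl i)) = w := by
    intro i hi
    obtain ⟨k, rfl⟩ := (splitTwo n hn).surjective i
    rcases k with k | k
    · fin_cases k
      · simp [splitTwo] at hi
      · exact hc1
    · exact hc2 k
  have hcol : ∀ u ∈ stab n, ∀ i j : Fin n, j.val = 0 → i.val ≠ 0 →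
      (u : Matrix (Fin n) (Fin n) ℝ) i j = 0 := by
    intro u hu i j hj hi
    have := congrFun (hu j hj) i
    rw [Matrix.mulVec_single_one] at this
    have hij : i ≠ j := fun h => hi (h ▸ hj)
    simpa [hij] using this
  -- Rows follow from columns because the inverse is the transpose.
  have hrow : ∀ i j : Fin n, i.val = 0 → j.val ≠ 0 →
      (u : Matrix (Fin n) (Fin n) ℝ) i j = 0 :=
    fun i j hi hj => hcol u⁻¹ (inv_mem hu) j i hi hj
  apply Subtype.ext
  rw [Matrix.SpecialLinearGroup.coe_mul, Matrix.SpecialLinearGroup.coe_mul]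
  ext i j
  obtain ⟨i, rfl⟩ := σ.surjective i
  obtain ⟨j, rfl⟩ := σ.surjective j
  simp only [expDiag, Matrix.diagonal_mul, Matrix.mul_diagonal, coe_embedSO]
  rw [mul_comm]
  rcases i with i | i <;> rcases j with j | j <;> simp
  · by_cases hi : i.val = 0 <;> by_cases hj : j.val = 0
    · left; rw [Fin.ext (hi.trans hj.symm)]
    · right; exact hrow i j hi hj
    · right; exact hcol u hu i j hj hi
    · left; rw [hc i hi, hc j hj]
  · by_cases h : i = j
    · left; rw [h]
    · right; exact Matrix.one_apply_ne h

/-- Lets the `SO(n)` block occupy arbitrary coordinates: `i`, then `m`, then an enumeration of `S`;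
`R` is the complement. -/
lemma exists_equiv (hn : 3 ≤ n) {i m : Fin N} (him : i ≠ m) {S : Finset (Fin N)}
    (hS : S.card = n - 2) (hi : i ∉ S) (hm : m ∉ S) :
    ∃ (R : Type) (_ : Fintype R) (_ : DecidableEq R) (σ : Fin n ⊕ R ≃ Fin N),
      splitPlane hn σ (.inl (.inl 0)) = i ∧ splitPlane hn σ (.inl (.inl 1)) = m ∧
      ∀ k, splitPlane hn σ (.inl (.inr k)) ∈ S := by
  classical
  let e := (S.equivFinOfCardEq hS).symm
  let f : Fin 2 ⊕ Fin (n - 2) → Fin N := Sum.elim ![i, m] fun k => e k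
  have hf : Function.Injective f := by
    refine Function.Injective.sumElim ?_ (Subtype.val_injective.comp e.injective) ?_
    · intro a b hab
      fin_cases a <;> fin_cases b <;> simp_all
    · intro a b hab
      have := (e b).2
      rw [← hab] at this
      fin_cases a
      · exact hi this
      · exact hm this
  let g : Fin n → Fin N := f ∘ (splitTwo n hn).symm
  have hg : Function.Injective g := hf.comp (splitTwo n hn).symm.injective
  refine ⟨((Set.range g)ᶜ : Set (Fin N)), inferInstance, inferInstance,
    ((Equiv.ofInjective g hg).sumCongr (Equiv.refl _)).trans (Equiv.Set.sumCompl _), ?_, ?_, ?_⟩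
  · simp [splitPlane, g, f]
  · simp [splitPlane, g, f]
  · intro k
    simp [splitPlane, g, f]

lemma exists_delta_of_le {x y z d : ℝ} (hd : 0 ≤ d) (hx : z + d ≤ x) (hy : z + d ≤ y) :
    ∃ δ : ℝ, |δ| ≤ Real.exp (-d) ∧
      δ * (Real.exp (x + y - z) - Real.exp z) = Real.exp x - Real.exp y := by
  -- If the denominator vanishes then `x = y = z`, and any `δ` solves the equation.
  rcases (show z ≤ x + y - z by linarith).eq_or_lt with h | h
  · obtain rfl : x = y := by linarith
    exact ⟨0, by simpa using (Real.exp_pos _).le, by simp⟩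
  · have hpos : 0 < Real.exp (x + y - z) - Real.exp z := by
      simpa using h
    refine ⟨(Real.exp x - Real.exp y) / (Real.exp (x + y - z) - Real.exp z), ?_, ?_⟩
    · rw [abs_div, abs_of_pos hpos, div_le_iff₀ hpos, mul_sub, ← Real.exp_add, ← Real.exp_add,
        abs_le]
      have h1 := Real.exp_le_exp.mpr (show x ≤ -d + (x + y - z) by linarith)
      have h2 := Real.exp_le_exp.mpr (show y ≤ -d + (x + y - z) by linarith)
      have h3 := Real.exp_le_exp.mpr (show -d + z ≤ x by linarith)
      have h4 := Real.exp_le_exp.mpr (show -d + z ≤ y by linarith)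
      constructor <;> linarith
    · field_simp

lemma exists_delta {x y z d : ℝ} (hd : 0 ≤ d)
    (h : (z + d ≤ x ∧ z + d ≤ y) ∨ (x ≤ z - d ∧ y ≤ z - d)) :
    ∃ δ : Set.Icc (-1 : ℝ) 1, |(δ : ℝ)| ≤ Real.exp (-d) ∧
      δ * (Real.exp (x + y - z) - Real.exp z) = Real.exp x - Real.exp y := by
  suffices ∃ δ : ℝ, |δ| ≤ Real.exp (-d) ∧
      δ * (Real.exp (x + y - z) - Real.exp z) = Real.exp x - Real.exp y by
    obtain ⟨δ, h1, h2⟩ := this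
    have h3 : |δ| ≤ 1 := h1.trans (Real.exp_le_one_iff.mpr (by linarith))
    exact ⟨⟨δ, abs_le.mp h3⟩, h1, h2⟩
  rcases h with ⟨hx, hy⟩ | ⟨hx, hy⟩
  · exact exists_delta_of_le hd hx hy
  -- Negating all exponents swaps the two sides; multiplying the resulting equation by `e^(x+y)`
  -- shows that the same `δ` works.
  · obtain ⟨δ, h1, h2⟩ := exists_delta_of_le (x := -x) (y := -y) (z := -z) hd
      (by linarith) (by linarith)
    refine ⟨δ, h1, ?_⟩
    have e1 : Real.exp (-x + -y - -z) * Real.exp (x + y) = Real.exp z := by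
      rw [← Real.exp_add]; congr 1; ring
    have e2 : Real.exp (-z) * Real.exp (x + y) = Real.exp (x + y - z) := by
      rw [← Real.exp_add]; congr 1; ring
    have e3 : Real.exp (-x) * Real.exp (x + y) = Real.exp y := by
      rw [← Real.exp_add]; congr 1; ring
    have e4 : Real.exp (-y) * Real.exp (x + y) = Real.exp x := by
      rw [← Real.exp_add]; congr 1; ring
    linear_combination -Real.exp (x + y) * h2 + δ * e1 - δ * e2 - e3 + e4

end Matrices

/-! ### Moving exponents of biinvariant coefficients. -/

section Coefficients

variable {n N : ℕ} {hn : 3 ≤ n} {C α : ℝ} {X : Type*} [NormedAddCommGroup X] [NormedSpace ℝ X]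
  {π : SL N →* (X ≃ₗᵢ[ℝ] X)} {ξ : X} {η : StrongDual ℝ X}

lemma sum_splitPlane {R : Type*} [Fintype R] (σ : Fin n ⊕ R ≃ Fin N) (a : Fin N → ℝ) :
    ∑ j, a j = a (splitPlane hn σ (.inl (.inl 0))) + a (splitPlane hn σ (.inl (.inl 1))) +
      ∑ k, a (splitPlane hn σ (.inl (.inr k))) + ∑ r, a (splitPlane hn σ (.inr r)) := by
  rw [← (splitPlane hn σ).sum_comp, Fintype.sum_sum_type, Fintype.sum_sum_type, Fin.sum_univ_two]

/-- Changing two exponents, with constant sum, that lie on the same side of an exponent of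
multiplicity `n - 2` changes the coefficient by little. -/
theorem abs_coeff_pair_sub_le [CompleteSpace X] (hX : SphereEstimate n hn X C α) (hα : 0 < α)
    (hπ : ∀ x : X, Continuous fun g => π g x)
    (hξ : ∀ k : SL N, (k : Matrix (Fin N) (Fin N) ℝ) ∈
      Matrix.specialOrthogonalGroup (Fin N) ℝ → π k ξ = ξ)
    (hη : ∀ k : SL N, (k : Matrix (Fin N) (Fin N) ℝ) ∈
      Matrix.specialOrthogonalGroup (Fin N) ℝ → ∀ x : X, η (π k x) = η x)
    {i m : Fin N} (him : i ≠ m) {S : Finset (Fin N)} (hS : S.card = n - 2) (hi : i ∉ S)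
    (hm : m ∉ S) {a a' : Fin N → ℝ} (ha : ∑ j, a j = 0)
    (haa' : ∀ j, j ≠ i → j ≠ m → a' j = a j) (hsum : a' i + a' m = a i + a m) {z d : ℝ}
    (hz : ∀ j ∈ S, a j = z) (hd : 0 ≤ d)
    (had : (z + d ≤ a i ∧ z + d ≤ a m) ∨ (a i ≤ z - d ∧ a m ≤ z - d))
    (had' : (z + d ≤ a' i ∧ z + d ≤ a' m) ∨ (a' i ≤ z - d ∧ a' m ≤ z - d)) :
    |η (π (expDiag a') ξ) - η (π (expDiag a) ξ)| ≤
      |C| * Real.exp (-α * d) * (‖ξ‖ * ‖η‖) := by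
  obtain ⟨R, _, _, σ, hσi, hσm, hσS⟩ := exists_equiv hn him hS hi hm
  have hne : ∀ j ∈ S, j ≠ i ∧ j ≠ m :=
    fun j hj => ⟨fun h => hi (h ▸ hj), fun h => hm (h ▸ hj)⟩
  have hz' : ∀ j ∈ S, a' j = z := fun j hj => by
    rw [haa' j (hne j hj).1 (hne j hj).2, hz j hj]
  have haR : ∀ r, a' (splitPlane hn σ (.inr r)) = a (splitPlane hn σ (.inr r)) := by
    intro r
    refine haa' _ (fun h => ?_) (fun h => ?_)
    · simpa using (splitPlane hn σ).injective (h.trans hσi.symm)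
    · simpa using (splitPlane hn σ).injective (h.trans hσm.symm)
  -- This depends only on `a i + a m`, on `z` and on the exponents off the block, so one `c` serves
  -- both `a` and `a'`.
  let c : Fin N → ℝ := fun j => Sum.elim (Sum.elim ![(a i + a m - z) / 2, z / 2] fun _ => z / 2)
    (fun r => a (splitPlane hn σ (.inr r)) / 2) ((splitPlane hn σ).symm j)
  have hc0 : c (splitPlane hn σ (.inl (.inl 0))) = (a i + a m - z) / 2 := by simp [c]
  have hc1 : c (splitPlane hn σ (.inl (.inl 1))) = z / 2 := by simp [c]
  have hc2 : ∀ k, c (splitPlane hn σ (.inl (.inr k))) = z / 2 := by simp [c]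
  have hc3 : ∀ r, c (splitPlane hn σ (.inr r)) = a (splitPlane hn σ (.inr r)) / 2 := by simp [c]
  have ha' : ∑ j, a' j = 0 := by
    rw [sum_splitPlane (hn := hn) σ] at ha ⊢
    simp only [haR, hσi, hσm, hz _ (hσS _), hz' _ (hσS _)] at ha ⊢
    linarith
  have hc : ∑ j, c j = 0 := by
    rw [sum_splitPlane (hn := hn) σ] at ha ⊢
    simp only [hσi, hσm, hz _ (hσS _)] at ha
    simp only [hc0, hc1, hc2, hc3, ← Finset.sum_div]
    linarith
  obtain ⟨δ, hδd, hδ⟩ := exists_delta hd had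
  obtain ⟨δ', hδd', hδ'⟩ := exists_delta hd had'
  obtain ⟨κ, hκ⟩ := embedSO_rotation_conj σ hn ha hc (by rw [hσi]) (by rw [hσm])
    (fun k => hz _ (hσS k)) hc0 hc1 hc2 hc3 hδ
  obtain ⟨κ', hκ'⟩ := embedSO_rotation_conj σ hn ha' hc (by rw [hσi]) (by rw [hσm])
    (fun k => hz' _ (hσS k)) (by rw [hsum]; exact hc0) hc1 hc2
    (fun r => by rw [haR]; exact hc3 r) hδ'
  let ρ : SO n →* (X ≃ₗᵢ[ℝ] X) := π.comp (embedSO σ)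
  let η' : StrongDual ℝ X :=
    η.comp ((π (expDiag c)).toContinuousLinearEquiv : X →L[ℝ] X)
  have hη' : ∀ x, η' x = η (π (expDiag c) x) := fun x => rfl
  have hη'norm : ‖η'‖ = ‖η‖ := η.opNorm_comp_linearIsometryEquiv _
  have hmul : ∀ (g h : SL N) (x : X), π g (π h x) = π (g * h) x := by
    intro g h x; rw [map_mul]; rfl
  have hρ : ∀ (g : SO n) (x : X), ρ g x = π (embedSO σ g) x := fun _ _ => rfl
  -- The outer rotations of the Cartan decomposition are absorbed by the invariance of `ξ` and `η`.
  have key : ∀ {b : Fin N → ℝ} {δ κ : Set.Icc (-1 : ℝ) 1},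
      expDiag c * embedSO σ (rotation n hn δ) * expDiag c =
        embedSO σ (rotation n hn κ) * expDiag b * embedSO σ (rotation n hn κ) →
      η' (ρ (rotation n hn δ) (π (expDiag c) ξ)) = η (π (expDiag b) ξ) := by
    intro b δ κ h
    rw [hη', hρ, hmul, hmul, h, mul_assoc, ← hmul, hη _ (embedSO_mem σ _), ← hmul,
      hξ _ (embedSO_mem σ _)]
  rw [← key hκ, ← key hκ']
  have hmain := abs_coeff_sub_le ρ
    (fun x => (hπ x).comp (continuous_embedSO σ)) (hX δ' δ) (π (expDiag c) ξ) η'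
    (fun u hu => by
      rw [hρ, hmul, ← embedSO_stab_commute σ hn hc1 hc2 hu, ← hmul, hξ _ (embedSO_mem σ _)])
    (fun u hu y => by
      rw [hη', hη', hρ, hmul, embedSO_stab_commute σ hn hc1 hc2 hu, ← hmul,
        hη _ (embedSO_mem σ _)])
  refine hmain.trans ?_
  rw [LinearIsometryEquiv.norm_map, hη'norm, mul_assoc]
  refine mul_le_mul_of_nonneg_right ?_ (by positivity)
  have hpow : ∀ t : ℝ, |t| ≤ Real.exp (-d) → |t| ^ α ≤ Real.exp (-α * d) := by
    intro t ht
    refine (Real.rpow_le_rpow (abs_nonneg t) ht hα.le).trans ?_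
    rw [← Real.exp_mul]
    apply le_of_eq; congr 1; ring
  refine mul_le_mul (le_abs_self C) (max_le (hpow _ hδd') (hpow _ hδd)) ?_ (abs_nonneg C)
  exact le_max_of_le_left (Real.rpow_nonneg (abs_nonneg _) _)

/-- Moving all exponents of a block by `r` against a single exponent `m`. -/
theorem abs_coeff_block_sub_le [CompleteSpace X] (hX : SphereEstimate n hn X C α) (hα : 0 < α)
    (hπ : ∀ x : X, Continuous fun g => π g x)
    (hξ : ∀ k : SL N, (k : Matrix (Fin N) (Fin N) ℝ) ∈
      Matrix.specialOrthogonalGroup (Fin N) ℝ → π k ξ = ξ)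
    (hη : ∀ k : SL N, (k : Matrix (Fin N) (Fin N) ℝ) ∈
      Matrix.specialOrthogonalGroup (Fin N) ℝ → ∀ x : X, η (π k x) = η x)
    {m : Fin N} {S : Finset (Fin N)} (hS : S.card = n - 2) (hm : m ∉ S) {a : Fin N → ℝ}
    (ha : ∑ j, a j = 0) {z d r : ℝ} (hz : ∀ j ∈ S, a j = z) (hd : 0 ≤ d)
    (P : Finset (Fin N)) (hmP : m ∉ P) (hPS : Disjoint P S)
    (had : (∀ j ≤ P.card, z + d ≤ a m - j * r) ∧
        (∀ i ∈ P, z + d ≤ a i ∧ z + d ≤ a i + r) ∨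
      (∀ j ≤ P.card, a m - j * r ≤ z - d) ∧ (∀ i ∈ P, a i ≤ z - d ∧ a i + r ≤ z - d)) :
    |η (π (expDiag fun j => if j = m then a m - P.card * r else if j ∈ P then a j + r else a j) ξ) -
        η (π (expDiag a) ξ)| ≤
      P.card * (|C| * Real.exp (-α * d) * (‖ξ‖ * ‖η‖)) := by
  classical
  have hsum : ∀ Q : Finset (Fin N), m ∉ Q →
      ∑ j, (if j = m then a m - Q.card * r else if j ∈ Q then a j + r else a j) = 0 := by
    intro Q hQ
    have : ∀ j, (if j = m then a m - Q.card * r else if j ∈ Q then a j + r else a j) =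
        a j + ((if j ∈ Q then r else 0) - if j = m then Q.card * r else 0) := by
      intro j
      by_cases h1 : j = m
      · subst h1; simp [hQ]; ring
      · by_cases h2 : j ∈ Q <;> simp [h1, h2]
    simp [this, Finset.sum_add_distrib, ha]
  induction P using Finset.induction_on with
  | empty =>
    have : (fun j => if j = m then a m else a j) = a := by
      ext j; split_ifs with h
      · rw [h]
      · rfl
    simp [this]
  | insert i Q hiQ ih =>
    have hmQ : m ∉ Q := fun h => hmP (Finset.mem_insert_of_mem h)
    have him : i ≠ m := fun h => hmP (h ▸ Finset.mem_insert_self i Q)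
    have hiS : i ∉ S := Finset.disjoint_left.mp hPS (Finset.mem_insert_self i Q)
    rw [Finset.card_insert_of_notMem hiQ] at had ⊢
    have ih' := ih hmQ (hPS.mono_left (Finset.subset_insert i Q)) (by
      refine had.imp ?_ ?_ <;> exact fun h => ⟨fun j hj => h.1 j (by omega),
        fun j hj => h.2 j (Finset.mem_insert_of_mem hj)⟩)
    -- Once `Q` has been moved, only `i` and `m` change: `i` gains `r` and `m` loses it.
    have hstep := abs_coeff_pair_sub_le hX hα hπ hξ hη him hS hiS hm (hsum Q hmQ)
      (a' := fun j => if j = m then a m - (Q.card + 1 : ℕ) * r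
        else if j ∈ insert i Q then a j + r else a j) (z := z) (d := d)
      (fun j h1 h2 => by simp [h1, h2])
      (by simp [him, hiQ]; ring)
      (fun j hj => by
        have h1 : j ≠ m := fun h => hm (h ▸ hj)
        have h2 : j ∉ Q := fun h => Finset.disjoint_left.mp hPS (Finset.mem_insert_of_mem h) hj
        simp [h1, h2, hz j hj]) hd
      (by
        simp only [him, hiQ, if_true, if_false]
        exact had.imp (fun h => ⟨(h.2 i (Finset.mem_insert_self i Q)).1, h.1 _ (by omega)⟩)
          (fun h => ⟨(h.2 i (Finset.mem_insert_self i Q)).1, h.1 _ (by omega)⟩))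
      (by
        simp only [him, Finset.mem_insert_self, if_true, if_false]
        exact had.imp (fun h => ⟨(h.2 i (Finset.mem_insert_self i Q)).2, h.1 _ le_rfl⟩)
          (fun h => ⟨(h.2 i (Finset.mem_insert_self i Q)).2, h.1 _ le_rfl⟩))
    refine (abs_sub_le _ _ _).trans ((add_le_add hstep ih').trans (le_of_eq ?_))
    push_cast
    ring

end Coefficients

/-- A function whose increments over unit steps decay exponentially converges exponentially. -/
lemma exists_limit_of_exp_increments {f : ℝ → ℝ} {K α : ℝ} (hα : 0 < α)
    (hf : ∀ s r : ℝ, 0 ≤ s → 0 ≤ r → r ≤ 1 → |f (s + r) - f s| ≤ K * Real.exp (-α * s)) :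
    ∃ c : ℝ, ∀ s : ℝ, 0 ≤ s →
      |f s - c| ≤ K * ((1 + (1 - Real.exp (-α))⁻¹) * Real.exp α) * Real.exp (-α * s) := by
  have hq : Real.exp (-α) < 1 := by simpa using hα
  have hpow : ∀ k : ℕ, Real.exp (-α) ^ k = Real.exp (-α * k) := by
    intro k; rw [← Real.exp_nat_mul]; congr 1; ring
  have hK : 0 ≤ K := by
    have := (abs_nonneg _).trans (hf 0 0 le_rfl le_rfl zero_le_one)
    simpa using this
  have hgeo : ∀ k : ℕ, dist (f k) (f (k + 1 : ℕ)) ≤ K * Real.exp (-α) ^ k := by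
    intro k
    rw [dist_comm, Real.dist_eq, hpow]
    push_cast
    exact hf k 1 k.cast_nonneg zero_le_one le_rfl
  obtain ⟨c, hc⟩ := cauchySeq_tendsto_of_complete (cauchySeq_of_le_geometric _ _ hq hgeo)
  refine ⟨c, fun s hs => ?_⟩
  have h1 := dist_le_of_le_geometric_of_tendsto _ _ hq hgeo hc ⌊s⌋₊
  have h2 := hf ⌊s⌋₊ (s - ⌊s⌋₊) (Nat.cast_nonneg _) (by linarith [Nat.floor_le hs])
    (by linarith [Nat.lt_floor_add_one s])
  rw [add_sub_cancel] at h2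
  rw [Real.dist_eq, hpow] at h1
  -- Rounding down loses less than one unit, at the cost of a factor `e^α`.
  have h3 : Real.exp (-α * ⌊s⌋₊) ≤ Real.exp α * Real.exp (-α * s) := by
    rw [← Real.exp_add, Real.exp_le_exp]
    nlinarith [Nat.lt_floor_add_one s]
  have h4 : 0 ≤ 1 + (1 - Real.exp (-α))⁻¹ := by
    have : 0 < 1 - Real.exp (-α) := by linarith
    positivity
  calc |f s - c| ≤ |f s - f ⌊s⌋₊| + |f ⌊s⌋₊ - c| := abs_sub_le _ _ _
    _ ≤ K * Real.exp (-α * ⌊s⌋₊) + K * Real.exp (-α * ⌊s⌋₊) / (1 - Real.exp (-α)) :=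
        add_le_add h2 h1
    _ = K * (1 + (1 - Real.exp (-α))⁻¹) * Real.exp (-α * ⌊s⌋₊) := by ring
    _ ≤ K * (1 + (1 - Real.exp (-α))⁻¹) * (Real.exp α * Real.exp (-α * s)) :=
        mul_le_mul_of_nonneg_left h3 (mul_nonneg hK h4)
    _ = _ := by ring

/-! ### Increments along `D(s, 0, -s)`. -/

section Increments

variable {n : ℕ} {hn : 3 ≤ n} {C α : ℝ} {X : Type*} [NormedAddCommGroup X] [NormedSpace ℝ X]
  {π : SL (2 * n - 3) →* (X ≃ₗᵢ[ℝ] X)} {ξ : X} {η : StrongDual ℝ X}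

lemma card_filter_lt (hn : 3 ≤ n) :
    (Finset.univ.filter fun i : Fin (2 * n - 3) => i.val < n - 2).card = n - 2 := by
  rw [Fin.card_filter_val_lt]; omega

lemma card_filter_gt (hn : 3 ≤ n) :
    (Finset.univ.filter fun i : Fin (2 * n - 3) => n - 2 < i.val).card = n - 2 := by
  have h := Finset.card_filter_add_card_filter_not (s := (Finset.univ : Finset (Fin (2 * n - 3))))
    (fun i : Fin (2 * n - 3) => n - 2 < i.val)
  have h2 : (Finset.univ.filter fun i : Fin (2 * n - 3) => ¬ n - 2 < i.val).card = n - 1 := by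
    have : (fun i : Fin (2 * n - 3) => ¬ n - 2 < i.val) = fun i => i.val < n - 1 := by
      ext i; omega
    simp only [this]
    rw [Fin.card_filter_val_lt]; omega
  simp at h h2 ⊢
  omega

/-- The exponents of `D(v, u, t)`. -/
def blockExp (n : ℕ) (v u t : ℝ) (i : Fin (2 * n - 3)) : ℝ :=
  if i.val < n - 2 then v else if i.val = n - 2 then u else t

lemma sum_blockExp (hn : 3 ≤ n) (v u t : ℝ) :
    ∑ i, blockExp n v u t i = ((n : ℝ) - 2) * v + u + ((n : ℝ) - 2) * t := by
  have h : ∀ i : Fin (2 * n - 3), blockExp n v u t i = (if i.val < n - 2 then v else 0) +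
      (if i = ⟨n - 2, by omega⟩ then u else 0) + (if n - 2 < i.val then t else 0) := by
    intro i
    unfold blockExp
    rcases lt_trichotomy i.val (n - 2) with h | h | h
    · simp [h, h.ne, h.not_gt, Fin.ext_iff]
    · simp [h, Fin.ext_iff]
    · simp [h, h.ne', h.not_gt, Fin.ext_iff]
  simp only [h, Finset.sum_add_distrib]
  rw [← Finset.sum_filter, ← Finset.sum_filter (fun i : Fin (2 * n - 3) => n - 2 < i.val),
    Finset.sum_const, Finset.sum_const, card_filter_lt hn, card_filter_gt hn]
  simp [Nat.cast_sub (show 2 ≤ n by omega)]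

lemma D_eq_expDiag (hn : 3 ≤ n) {v u t : ℝ} (h : t + u / ((n : ℝ) - 2) + v = 0) :
    D n hn v u t h = expDiag (blockExp n v u t) := by
  have h3 : (3 : ℝ) ≤ n := by exact_mod_cast hn
  have h0 : (n : ℝ) - 2 ≠ 0 := by linarith
  have hs : ∑ i, blockExp n v u t i = 0 := by
    rw [sum_blockExp hn]
    field_simp at h
    linear_combination h
  apply Subtype.ext
  rw [coe_expDiag hs]
  unfold D blockExp
  simp only [apply_ite Real.exp]

/-- Moving from `D(s, 0, -s)` to `D(s + r, 0, -s - r)` through `D(s + r, -(n - 2) r, -s)`. -/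
theorem abs_coeff_add_sub_le [CompleteSpace X] (hX : SphereEstimate n hn X C α) (hα : 0 < α)
    (hπ : ∀ x : X, Continuous fun g => π g x)
    (hξ : ∀ k : SL (2 * n - 3), (k : Matrix (Fin (2 * n - 3)) (Fin (2 * n - 3)) ℝ) ∈
      Matrix.specialOrthogonalGroup (Fin (2 * n - 3)) ℝ → π k ξ = ξ)
    (hη : ∀ k : SL (2 * n - 3), (k : Matrix (Fin (2 * n - 3)) (Fin (2 * n - 3)) ℝ) ∈
      Matrix.specialOrthogonalGroup (Fin (2 * n - 3)) ℝ → ∀ x : X, η (π k x) = η x)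
    {s r : ℝ} (hs : (n : ℝ) - 2 ≤ s) (hr : 0 ≤ r) (hr1 : r ≤ 1) :
    |η (π (expDiag (blockExp n (s + r) 0 (-(s + r)))) ξ) -
        η (π (expDiag (blockExp n s 0 (-s))) ξ)| ≤
      2 * ((n : ℝ) - 2) * (|C| * Real.exp (-α * (s - (n - 2))) * (‖ξ‖ * ‖η‖)) := by
  have h3 : (3 : ℝ) ≤ n := by exact_mod_cast hn
  have hcast : ((n - 2 : ℕ) : ℝ) = (n : ℝ) - 2 := by rw [Nat.cast_sub (by omega)]; norm_num
  have hj : ∀ j : ℕ, j ≤ n - 2 → (j : ℝ) ≤ (n : ℝ) - 2 := fun j hj => by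
    rw [← hcast]; exact_mod_cast hj
  let m : Fin (2 * n - 3) := ⟨n - 2, by omega⟩
  let P := Finset.univ.filter fun i : Fin (2 * n - 3) => i.val < n - 2
  let Q := Finset.univ.filter fun i : Fin (2 * n - 3) => n - 2 < i.val
  have hP : P.card = n - 2 := card_filter_lt hn
  have hQ : Q.card = n - 2 := card_filter_gt hn
  have hPQ : Disjoint P Q := Finset.disjoint_left.mpr fun i hi hi' => by
    simp [P, Q] at hi hi'; omega
  have hmP : m ∉ P := by simp [P, m]
  have hmQ : m ∉ Q := by simp [Q, m]
  have bm : ∀ v u t, blockExp n v u t m = u := by intros; simp [blockExp, m]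
  have bP : ∀ v u t, ∀ i ∈ P, blockExp n v u t i = v := by
    intro v u t i hi
    simp only [P, Finset.mem_filter, Finset.mem_univ, true_and] at hi
    simp [blockExp, hi]
  have bQ : ∀ v u t, ∀ i ∈ Q, blockExp n v u t i = t := by
    intro v u t i hi
    simp only [Q, Finset.mem_filter, Finset.mem_univ, true_and] at hi
    simp [blockExp, hi.not_gt, hi.ne']
  have hcases : ∀ i, i = m ∨ i ∈ P ∨ i ∈ Q := by
    intro i
    simp only [P, Q, m, Finset.mem_filter, Finset.mem_univ, true_and, Fin.ext_iff]
    omega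
  have hne : ∀ i, i ∈ P ∨ i ∈ Q → i ≠ m := by
    rintro i hi rfl
    exact hi.elim hmP hmQ
  have e1 : (fun j => if j = m then blockExp n s 0 (-s) m - P.card * r else
      if j ∈ P then blockExp n s 0 (-s) j + r else blockExp n s 0 (-s) j) =
      blockExp n (s + r) (-((n - 2) * r)) (-s) := by
    ext i
    rcases hcases i with rfl | hi | hi
    · simp [bm, hP, hcast]
    · simp [hne i (.inl hi), hi, bP _ _ _ i hi]
    · simp [hne i (.inr hi), Finset.disjoint_right.mp hPQ hi, bQ _ _ _ i hi]
  have e2 : (fun j => if j = m then blockExp n (s + r) (-((n - 2) * r)) (-s) m - Q.card * (-r) else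
      if j ∈ Q then blockExp n (s + r) (-((n - 2) * r)) (-s) j + -r else
        blockExp n (s + r) (-((n - 2) * r)) (-s) j) =
      blockExp n (s + r) 0 (-(s + r)) := by
    ext i
    rcases hcases i with rfl | hi | hi
    · simp [bm, hQ, hcast]
    · simp [hne i (.inl hi), Finset.disjoint_left.mp hPQ hi, bP _ _ _ i hi]
    · simp [hne i (.inr hi), hi, bQ _ _ _ i hi]; ring
  have hjr : ∀ j : ℕ, j ≤ n - 2 → 0 ≤ j * r ∧ j * r ≤ (n : ℝ) - 2 := fun j hj' =>
    ⟨by positivity, by nlinarith [hj j hj', (Nat.cast_nonneg j : (0 : ℝ) ≤ j)]⟩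
  -- The last block, at `-s`, is the repeated exponent. The middle exponent descends to `-(n-2)r ≥
  -- -(n-2)`, which leaves the gap `d = s - (n-2)`.
  have step1 := abs_coeff_block_sub_le hX hα hπ hξ hη hQ hmQ (a := blockExp n s 0 (-s)) (r := r)
    (z := -s) (d := s - (n - 2)) (by rw [sum_blockExp hn]; ring) (bQ _ _ _) (by linarith) P hmP hPQ
    (.inl ⟨fun j hj' => by
      rw [bm]; rw [hP] at hj'; linarith [hjr j hj'], fun i hi => by
      rw [bP _ _ _ i hi]; constructor <;> linarith⟩)
  -- Now the first block, at `s + r`, is the repeated exponent, and the middle one climbs back to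
  -- `0`; the moved exponents all lie below it by more than enough for the same `d`.
  have step2 := abs_coeff_block_sub_le hX hα hπ hξ hη hP hmP
    (a := blockExp n (s + r) (-((n - 2) * r)) (-s)) (r := -r)
    (z := s + r) (d := s - (n - 2)) (by rw [sum_blockExp hn]; ring) (bP _ _ _) (by linarith) Q hmQ
    hPQ.symm
    (.inr ⟨fun j hj' => by
      rw [bm]; rw [hQ] at hj'
      have := mul_le_mul_of_nonneg_right (hj j hj') hr
      linarith, fun i hi => by
      rw [bQ _ _ _ i hi]; constructor <;> linarith⟩)
  rw [e1, hP, hcast] at step1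
  rw [e2, hQ, hcast] at step2
  refine (abs_sub_le _ _ _).trans ((add_le_add step2 step1).trans (le_of_eq ?_))
  ring

end Increments

end SLCoeff

/-! ### Exponential convergence of the coefficient. -/

theorem proposition5p10 (n : ℕ) (hn : 3 ≤ n) (C α : ℝ) (hα : 0 < α) :
    ∃ ε : C₀(ℝ≥0, ℝ),
      ∀ (X : Type*) [NormedAddCommGroup X] [NormedSpace ℝ X] [CompleteSpace X],
        SLCoeff.SphereEstimate n hn X C α →
        ∀ π : SLCoeff.SL (2 * n - 3) →* (X ≃ₗᵢ[ℝ] X),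
          (∀ x : X, Continuous fun g => π g x) →
          ∀ (ξ : X) (η : StrongDual ℝ X),
            (∀ k : SLCoeff.SL (2 * n - 3),
              (k : Matrix (Fin (2 * n - 3)) (Fin (2 * n - 3)) ℝ) ∈
                Matrix.specialOrthogonalGroup (Fin (2 * n - 3)) ℝ → π k ξ = ξ) →
            (∀ k : SLCoeff.SL (2 * n - 3),
              (k : Matrix (Fin (2 * n - 3)) (Fin (2 * n - 3)) ℝ) ∈
                Matrix.specialOrthogonalGroup (Fin (2 * n - 3)) ℝ →
                  ∀ x : X, η (π k x) = η x) →
            ∃ c : ℝ,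
              Tendsto (fun t : ℝ => η (π (SLCoeff.D n hn t 0 (-t) (by simp)) ξ)) atTop (𝓝 c) ∧
              ∀ t : ℝ≥0,
                |η (π (SLCoeff.D n hn t 0 (-t) (by simp)) ξ) - c| ≤ ε t * ‖ξ‖ * ‖η‖ := by
  have h3 : (3 : ℝ) ≤ n := by exact_mod_cast hn
  -- The summand `2` covers `s ≤ n - 2`, where only `|f| ≤ ‖ξ‖ ‖η‖` is used; the exponential absorbs
  -- the shift of `s` by `n - 2`. `B` is the factor from `exists_limit_of_exp_increments`.
  let A : ℝ := (2 * ((n : ℝ) - 2) * |C| + 2) * Real.exp (α * (n - 2))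
  let B : ℝ := (1 + (1 - Real.exp (-α))⁻¹) * Real.exp α
  have hexp : Tendsto (fun t : ℝ => Real.exp (-α * t)) atTop (𝓝 0) :=
    Real.tendsto_exp_atBot.comp (tendsto_id.const_mul_atTop_of_neg (by linarith))
  have hε : Tendsto (fun t : ℝ≥0 => A * B * Real.exp (-α * t)) (cocompact ℝ≥0) (𝓝 0) := by
    simpa using ((hexp.comp (NNReal.tendsto_coe_atTop.mpr tendsto_id)).const_mul (A * B)).mono_left
      cocompact_le_atTop
  refine ⟨⟨⟨fun t => A * B * Real.exp (-α * t), by fun_prop⟩, hε⟩, ?_⟩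
  intro X _ _ _ hX π hπ ξ η hξ hη
  let f : ℝ → ℝ := fun t => η (π (SLCoeff.D n hn t 0 (-t) (by simp)) ξ)
  have hf : ∀ t, f t = η (π (SLCoeff.expDiag (SLCoeff.blockExp n t 0 (-t))) ξ) := fun t => by
    simp only [f, SLCoeff.D_eq_expDiag]
  have hbound : ∀ t, |f t| ≤ ‖ξ‖ * ‖η‖ := by
    intro t
    have := η.le_opNorm (π (SLCoeff.D n hn t 0 (-t) (by simp)) ξ)
    rw [LinearIsometryEquiv.norm_map] at this
    exact this.trans_eq (mul_comm _ _)
  have hinc : ∀ s r : ℝ, 0 ≤ s → 0 ≤ r → r ≤ 1 →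
      |f (s + r) - f s| ≤ A * (‖ξ‖ * ‖η‖) * Real.exp (-α * s) := by
    intro s r hs hr hr1
    have hA : A * (‖ξ‖ * ‖η‖) * Real.exp (-α * s) =
        (2 * ((n : ℝ) - 2) * |C| + 2) * (‖ξ‖ * ‖η‖) * Real.exp (-α * (s - (n - 2))) := by
      have : Real.exp (-α * (s - (n - 2))) = Real.exp (α * (n - 2)) * Real.exp (-α * s) := by
        rw [← Real.exp_add]; congr 1; ring
      rw [this]; ring
    have hCn : 0 ≤ 2 * ((n : ℝ) - 2) * |C| := mul_nonneg (by linarith) (abs_nonneg C)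
    have hN : 0 ≤ ‖ξ‖ * ‖η‖ := by positivity
    rw [hA]
    rcases le_total ((n : ℝ) - 2) s with h | h
    · rw [hf, hf]
      refine (SLCoeff.abs_coeff_add_sub_le hX hα hπ hξ hη h hr hr1).trans ?_
      have : 0 ≤ 2 * (‖ξ‖ * ‖η‖) * Real.exp (-α * (s - (n - 2))) := by positivity
      linarith
    · have h1 : (1 : ℝ) ≤ Real.exp (-α * (s - (n - 2))) :=
        Real.one_le_exp (by nlinarith)
      have h2 := abs_sub (f (s + r)) (f s)
      have h3 : 0 ≤ 2 * ((n : ℝ) - 2) * |C| * (‖ξ‖ * ‖η‖) := mul_nonneg hCn hN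
      have h4 : (2 * ((n : ℝ) - 2) * |C| + 2) * (‖ξ‖ * ‖η‖) ≤
          (2 * ((n : ℝ) - 2) * |C| + 2) * (‖ξ‖ * ‖η‖) * Real.exp (-α * (s - (n - 2))) :=
        le_mul_of_one_le_right (by positivity) h1
      linarith [hbound (s + r), hbound s]
  obtain ⟨c, hc⟩ := SLCoeff.exists_limit_of_exp_increments hα hinc
  refine ⟨c, ?_, fun t => (hc t t.2).trans (le_of_eq ?_)⟩
  · rw [tendsto_iff_dist_tendsto_zero]
    refine squeeze_zero' (Eventually.of_forall fun _ => dist_nonneg)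
      ((eventually_ge_atTop 0).mono fun s hs => hc s hs) ?_
    simpa using hexp.const_mul (A * (‖ξ‖ * ‖η‖) * B)
  · change _ = A * B * Real.exp (-α * t) * ‖ξ‖ * ‖η‖
    ring
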